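/- There is an absolute constant $C$ such that the following holds. Let $n\ge 2$, let $a_{ij}$ ($1\le i\le j\le n$) be independent real random variables with $|a_{ij}|\le 1$, all with mean $0$ and common variance $\sigma^2$ ($\sigma\ge 0$; the $a_{ij}$ need not be identically distributed, and $\sigma$ may depend on $n$), and let $A$ be the symmetric $n\times n$ matrix with entries $a_{ij}$ and $a_{ji}=a_{ij}$. Let $\lambda_1(A)$ be the largest absolute value of an eigenvalue of $A$. Then $$\mathbb E[\lambda_1(A)]\ \ge\ 2\sigma\sqrt n - C\sqrt{\log n}.$$ Consequently, with probability tending to $1$ as $n\to\infty$, $\lambda_1(A)\ge 2\sigma\sqrt n - C\sqrt{\log n}$: for every $\varepsilon>0$ there is $N$ such that for all $n\ge N$ and all such matrices $A$ of order $n$, $$\Pr\bigl[\lambda_1(A)\ge 2\sigma\sqrt n - C\sqrt{\log n}\,\bigr]\ \ge\ 1-\varepsilon .$$ -/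

import Mathlib

open MeasureTheory ProbabilityTheory

/-- `lambda1 hA` is the largest absolute value of an eigenvalue of the real symmetric matrix `A`
(eigenvalues listed with multiplicity by `Matrix.IsHermitian.eigenvalues`). -/
noncomputable def lambda1 {n : ℕ} {A : Matrix (Fin n) (Fin n) ℝ} (hA : A.IsHermitian) : ℝ :=
  ⨆ i, |hA.eigenvalues i|

/-- The random symmetric matrix model: `A` is a real symmetric random matrix of order `n` whose
entries on and above the diagonal are (jointly) independent random variables with absolute
value at most `1`. No identical distribution is assumed. -/
structure IsRandomSymmetric {Ω : Type*} [MeasurableSpace Ω] (μ : Measure Ω) {n : ℕ}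
    (A : Ω → Matrix (Fin n) (Fin n) ℝ) : Prop where
  isHermitian : ∀ ω, (A ω).IsHermitian
  measurable_entry : ∀ i j, Measurable fun ω => A ω i j
  indep : iIndepFun
    (fun (p : {p : Fin n × Fin n // p.1 ≤ p.2}) (ω : Ω) => A ω p.1.1 p.1.2) μ
  abs_entry_le_one : ∀ i j, ∀ᵐ ω ∂μ, |A ω i j| ≤ 1


/-!
Write `R` for the resolvent of `A` at the random spectral parameter `‖A‖ + 1`, so that `R` is
positive and bounded by one. By the Schur complement formula a diagonal entry of `R` is essentially
`1 / (‖A‖ + 1 - A i i - q i)`, where `q i` is the quadratic form of the resolvent of the `i`-th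
minor at the `i`-th row. The minor has its own norm as spectral parameter, and an eigenvector for
the norm of `A` shows that the differences of norms sum to at most `3 * ‖A‖`. As only lower bounds
on `R i i` are needed, test vectors replace the formula, and `1 / x ≥ 2 * c - c ^ 2 * x` makes them
linear, so that expectations may be taken. The row is independent of its minor, whence `q i` has
mean at least `σ ^ 2 * (E tr R - 1)`, and for `c = 1 / (σ * √n)` the trace terms cancel, leaving
`2 * σ * √n ≤ E ‖A‖ + O(1 + E ‖A‖ ^ 2 / n)`.

By the Efron–Stein inequality the variance of `‖A‖` is at most `16`: resampling the entry `(i, j)`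
decreases the norm by at most `4 * |u i * u j|`, where `u` is a unit eigenvector of `A` for the
norm. This bounds `E ‖A‖ ^ 2` in terms of `E ‖A‖`, and Chebyshev's inequality gives the
concentration.
-/

open scoped Matrix Matrix.Norms.L2Operator

section OperatorNorm

variable {ι : Type*} [Fintype ι] [DecidableEq ι] {A B : Matrix ι ι ℝ} {u : ι → ℝ}

lemma abs_dotProduct_mulVec_le_norm_mul (A : Matrix ι ι ℝ) (x : ι → ℝ) :
    |x ⬝ᵥ A *ᵥ x| ≤ ‖A‖ * (x ⬝ᵥ x) := by
  let v : EuclideanSpace ℝ ι := WithLp.toLp 2 x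
  calc |x ⬝ᵥ A *ᵥ x| = |inner ℝ v (Matrix.toEuclideanCLM (𝕜 := ℝ) A v)| := by
        rw [Matrix.inner_toEuclideanCLM]
    _ ≤ ‖v‖ * ‖Matrix.toEuclideanCLM (𝕜 := ℝ) A v‖ := abs_real_inner_le_norm _ _
    _ ≤ ‖v‖ * (‖A‖ * ‖v‖) := by gcongr; exact ContinuousLinearMap.le_opNorm _ _
    _ = ‖A‖ * ‖v‖ ^ 2 := by ring
    _ = ‖A‖ * (x ⬝ᵥ x) := by
        rw [EuclideanSpace.real_norm_sq_eq]
        simp only [dotProduct, v, sq]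

lemma norm_eq_iSup_abs_eigenvalues (hA : A.IsHermitian) :
    ‖A‖ = ⨆ i, |hA.eigenvalues i| := by
  have hdiag : ‖A‖ = ‖hA.eigenvalues‖ := by
    conv_lhs => rw [hA.spectral_theorem]
    rw [Unitary.conjStarAlgAut_apply, ← Unitary.coe_star, CStarRing.norm_mul_coe_unitary,
      CStarRing.norm_coe_unitary_mul, Matrix.l2_opNorm_diagonal]
    rfl
  have hnonneg : 0 ≤ ⨆ i, |hA.eigenvalues i| := Real.iSup_nonneg fun i => abs_nonneg _
  rw [hdiag]
  refine le_antisymm ((pi_norm_le_iff_of_nonneg hnonneg).2 fun i => ?_)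
    (Real.iSup_le (norm_le_pi_norm hA.eigenvalues) (norm_nonneg _))
  exact le_ciSup (f := fun i => |hA.eigenvalues i|) (Set.finite_range _).bddAbove i

lemma lambda1_eq_norm {n : ℕ} {A : Matrix (Fin n) (Fin n) ℝ} (hA : A.IsHermitian) :
    lambda1 hA = ‖A‖ :=
  (norm_eq_iSup_abs_eigenvalues hA).symm

lemma exists_eigenvector_abs_eigenvalue_eq_norm [Nonempty ι] (hA : A.IsHermitian) :
    ∃ (u : ι → ℝ) (r : ℝ), u ⬝ᵥ u = 1 ∧ A *ᵥ u = r • u ∧ |r| = ‖A‖ := by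
  obtain ⟨i, hi⟩ := exists_eq_ciSup_of_finite (f := fun i => |hA.eigenvalues i|)
  refine ⟨hA.eigenvectorBasis i, hA.eigenvalues i, ?_, hA.mulVec_eigenvectorBasis i,
    hi.trans (norm_eq_iSup_abs_eigenvalues hA).symm⟩
  have := hA.eigenvectorBasis.inner_eq_one i
  rwa [EuclideanSpace.inner_eq_star_dotProduct, star_trivial] at this

lemma norm_sub_norm_le_abs_dotProduct {r : ℝ} (hu : u ⬝ᵥ u = 1) (hAu : A *ᵥ u = r • u)
    (hr : |r| = ‖A‖) (B : Matrix ι ι ℝ) : ‖A‖ - ‖B‖ ≤ |u ⬝ᵥ (A - B) *ᵥ u| := by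
  have hB := abs_dotProduct_mulVec_le_norm_mul B u
  rw [hu, mul_one] at hB
  have hA : u ⬝ᵥ A *ᵥ u = r := by rw [hAu, dotProduct_smul, hu, smul_eq_mul, mul_one]
  rw [Matrix.sub_mulVec, dotProduct_sub, hA, ← hr]
  linarith [abs_sub_abs_le_abs_sub r (u ⬝ᵥ B *ᵥ u)]

lemma abs_diag_le_norm (A : Matrix ι ι ℝ) (i : ι) : |A i i| ≤ ‖A‖ := by
  simpa using abs_dotProduct_mulVec_le_norm_mul A (Pi.single i 1)

end OperatorNorm

section CoerciveInverse

variable {ι : Type*} [Fintype ι] [DecidableEq ι] {M : Matrix ι ι ℝ}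

lemma two_mul_dotProduct_sub_le_dotProduct_inv_mulVec (hM : M.PosDef) (x w : ι → ℝ) :
    2 * (x ⬝ᵥ w) - w ⬝ᵥ M *ᵥ w ≤ x ⬝ᵥ M⁻¹ *ᵥ x := by
  set y := M⁻¹ *ᵥ x
  have hMy : M *ᵥ y = x := by
    rw [Matrix.mulVec_mulVec,
      Matrix.mul_nonsing_inv _ ((Matrix.isUnit_iff_isUnit_det M).1 hM.isUnit), Matrix.one_mulVec]
  have hsymm : y ⬝ᵥ M *ᵥ w = x ⬝ᵥ w := by
    rw [Matrix.dotProduct_mulVec, ← Matrix.mulVec_transpose,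
      ← Matrix.conjTranspose_eq_transpose_of_trivial, hM.isHermitian.eq, hMy]
  have hnonneg : 0 ≤ (w - y) ⬝ᵥ M *ᵥ (w - y) := by
    simpa using hM.posSemidef.dotProduct_mulVec_nonneg (w - y)
  rw [Matrix.mulVec_sub, hMy, dotProduct_sub, sub_dotProduct, sub_dotProduct, hsymm,
    dotProduct_comm w x, dotProduct_comm y x] at hnonneg
  linarith

end CoerciveInverse

section EdgeResolvent

variable {ι : Type*} [Fintype ι] [DecidableEq ι] {A : Matrix ι ι ℝ}

/-- The resolvent of `A` at the spectral parameter `‖A‖ + 1`, which stays at distance at least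
one from the spectrum of `A`. -/
noncomputable def edgeResolvent (A : Matrix ι ι ℝ) : Matrix ι ι ℝ :=
  ((‖A‖ + 1) • (1 : Matrix ι ι ℝ) - A)⁻¹

lemma dotProduct_edge_mulVec (A : Matrix ι ι ℝ) (w : ι → ℝ) :
    w ⬝ᵥ ((‖A‖ + 1) • (1 : Matrix ι ι ℝ) - A) *ᵥ w = (‖A‖ + 1) * (w ⬝ᵥ w) - w ⬝ᵥ A *ᵥ w := by
  rw [Matrix.sub_mulVec, dotProduct_sub, Matrix.smul_mulVec, Matrix.one_mulVec, dotProduct_smul,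
    smul_eq_mul]

lemma dotProduct_self_le_edge (A : Matrix ι ι ℝ) (w : ι → ℝ) :
    w ⬝ᵥ w ≤ (‖A‖ + 1) * (w ⬝ᵥ w) - w ⬝ᵥ A *ᵥ w := by
  linarith [(abs_le.1 (abs_dotProduct_mulVec_le_norm_mul A w)).2]

lemma posDef_edge (hA : A.IsHermitian) : ((‖A‖ + 1) • (1 : Matrix ι ι ℝ) - A).PosDef := by
  refine .of_dotProduct_mulVec_pos ((Matrix.isHermitian_one.smul (.all _)).sub hA) fun x hx => ?_
  rw [star_trivial, dotProduct_edge_mulVec]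
  exact (Matrix.dotProduct_star_self_pos_iff.2 hx).trans_le (dotProduct_self_le_edge A x)

lemma isHermitian_edgeResolvent (hA : A.IsHermitian) : (edgeResolvent A).IsHermitian :=
  (posDef_edge hA).inv.isHermitian

lemma edgeResolvent_diag_pos (hA : A.IsHermitian) (i : ι) : 0 < edgeResolvent A i i :=
  (posDef_edge hA).inv.diag_pos

lemma edge_mulVec_edgeResolvent_mulVec (hA : A.IsHermitian) (x : ι → ℝ) :
    (‖A‖ + 1) • (edgeResolvent A *ᵥ x) - A *ᵥ (edgeResolvent A *ᵥ x) = x := by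
  have hunit := (Matrix.isUnit_iff_isUnit_det _).1 (posDef_edge hA).isUnit
  have h : ((‖A‖ + 1) • (1 : Matrix ι ι ℝ) - A) *ᵥ edgeResolvent A *ᵥ x = x := by
    rw [edgeResolvent, Matrix.mulVec_mulVec, Matrix.mul_nonsing_inv _ hunit, Matrix.one_mulVec]
  rwa [Matrix.sub_mulVec, Matrix.smul_mulVec, Matrix.one_mulVec] at h

lemma le_dotProduct_edgeResolvent_mulVec (hA : A.IsHermitian) (x w : ι → ℝ) :
    2 * (x ⬝ᵥ w) - ((‖A‖ + 1) * (w ⬝ᵥ w) - w ⬝ᵥ A *ᵥ w) ≤ x ⬝ᵥ edgeResolvent A *ᵥ x := by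
  rw [← dotProduct_edge_mulVec]
  exact two_mul_dotProduct_sub_le_dotProduct_inv_mulVec (posDef_edge hA) x w

lemma dotProduct_self_edgeResolvent_mulVec_le (hA : A.IsHermitian) (x : ι → ℝ) :
    edgeResolvent A *ᵥ x ⬝ᵥ edgeResolvent A *ᵥ x ≤ edgeResolvent A *ᵥ x ⬝ᵥ x := by
  refine (dotProduct_self_le_edge A _).trans_eq ?_
  conv_rhs => rw [← edge_mulVec_edgeResolvent_mulVec hA x]
  rw [dotProduct_sub, dotProduct_smul, smul_eq_mul]
  rw [edge_mulVec_edgeResolvent_mulVec hA x]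

lemma sum_sq_edgeResolvent_le (hA : A.IsHermitian) (i : ι) :
    ∑ j, edgeResolvent A j i ^ 2 ≤ edgeResolvent A i i := by
  have h := dotProduct_self_edgeResolvent_mulVec_le hA (Pi.single i 1)
  rw [Matrix.mulVec_single_one, dotProduct_single_one] at h
  simpa only [dotProduct, Matrix.col_apply, ← sq] using h

lemma abs_edgeResolvent_apply_le_one (hA : A.IsHermitian) (i j : ι) :
    |edgeResolvent A i j| ≤ 1 := by
  have hle : ∀ k, edgeResolvent A k j ^ 2 ≤ edgeResolvent A j j := fun k =>
    (Finset.single_le_sum (fun k _ => sq_nonneg (edgeResolvent A k j)) (Finset.mem_univ k)).trans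
      (sum_sq_edgeResolvent_le hA j)
  rw [← sq_le_one_iff_abs_le_one]
  nlinarith [hle i, hle j, edgeResolvent_diag_pos hA j]

end EdgeResolvent

section ZeroRowCol

variable {ι : Type*} [Fintype ι] [DecidableEq ι] {A : Matrix ι ι ℝ}

/-- The matrix `A` with row `i` and column `i` replaced by zeros. It stands for the minor obtained
by deleting them, keeping the same index type. -/
def zeroRowCol (A : Matrix ι ι ℝ) (i : ι) : Matrix ι ι ℝ :=
  Matrix.of fun j k => if j = i ∨ k = i then 0 else A j k

/-- The `i`-th row of `A` with its diagonal entry replaced by zero. -/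
def offDiagRow (A : Matrix ι ι ℝ) (i : ι) : ι → ℝ :=
  Function.update (A i) i 0

/-- The quadratic form of the edge resolvent of the `i`-th minor at the `i`-th row, which is what
the Schur complement formula subtracts from the `i`-th diagonal entry. -/
noncomputable def schurForm (A : Matrix ι ι ℝ) (i : ι) : ℝ :=
  offDiagRow A i ⬝ᵥ edgeResolvent (zeroRowCol A i) *ᵥ offDiagRow A i

omit [Fintype ι] in
lemma isHermitian_zeroRowCol (hA : A.IsHermitian) (i : ι) : (zeroRowCol A i).IsHermitian := by
  ext j k
  simp only [zeroRowCol, Matrix.conjTranspose_apply, Matrix.of_apply, or_comm, star_trivial]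
  rw [← hA.apply j k, star_trivial]

omit [DecidableEq ι] in
lemma dotProduct_col_eq_mulVec_apply (hA : A.IsHermitian) (x : ι → ℝ) (i : ι) :
    x ⬝ᵥ A.col i = (A *ᵥ x) i := by
  rw [dotProduct_comm]
  exact Finset.sum_congr rfl fun j _ => by rw [Matrix.col_apply, ← hA.apply, star_trivial]

lemma dotProduct_zeroRowCol_mulVec (A : Matrix ι ι ℝ) (i : ι) (x : ι → ℝ) :
    x ⬝ᵥ zeroRowCol A i *ᵥ x = Function.update x i 0 ⬝ᵥ A *ᵥ Function.update x i 0 := by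
  simp only [dotProduct, Matrix.mulVec, Finset.mul_sum]
  refine Finset.sum_congr rfl fun j _ => Finset.sum_congr rfl fun k _ => ?_
  by_cases hj : j = i <;> by_cases hk : k = i <;> simp [zeroRowCol, hj, hk]

lemma dotProduct_zeroRowCol_mulVec_of_apply_eq_zero {w : ι → ℝ} {i : ι} (hw : w i = 0) :
    w ⬝ᵥ zeroRowCol A i *ᵥ w = w ⬝ᵥ A *ᵥ w := by
  rw [dotProduct_zeroRowCol_mulVec, Function.update_eq_self_iff.2 hw.symm]

lemma norm_zeroRowCol_le (hA : A.IsHermitian) (i : ι) : ‖zeroRowCol A i‖ ≤ ‖A‖ := by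
  have : Nonempty ι := ⟨i⟩
  obtain ⟨u, r, hu, hru, hr⟩ :=
    exists_eigenvector_abs_eigenvalue_eq_norm (isHermitian_zeroRowCol hA i)
  have hr' : u ⬝ᵥ zeroRowCol A i *ᵥ u = r := by
    rw [hru, dotProduct_smul, hu, smul_eq_mul, mul_one]
  have hle : Function.update u i 0 ⬝ᵥ Function.update u i 0 ≤ 1 := by
    rw [← hu]
    refine Finset.sum_le_sum fun j _ => ?_
    by_cases hj : j = i
    · simp [hj, mul_self_nonneg]
    · simp [hj]
  rw [← hr, ← hr', dotProduct_zeroRowCol_mulVec]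
  exact (abs_dotProduct_mulVec_le_norm_mul A _).trans (mul_le_of_le_one_right (norm_nonneg A) hle)

lemma dotProduct_sub_zeroRowCol_mulVec (hA : A.IsHermitian) (i : ι) (u : ι → ℝ) :
    u ⬝ᵥ (A - zeroRowCol A i) *ᵥ u = 2 * u i * (A *ᵥ u) i - u i ^ 2 * A i i := by
  have hupd : Function.update u i 0 = u - u i • Pi.single i 1 := by
    ext j
    by_cases hj : j = i
    · subst hj; simp
    · simp [hj]
  rw [Matrix.sub_mulVec, dotProduct_sub, dotProduct_zeroRowCol_mulVec, hupd, Matrix.mulVec_sub,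
    Matrix.mulVec_smul, dotProduct_sub, sub_dotProduct, sub_dotProduct, dotProduct_smul,
    smul_dotProduct, smul_dotProduct, dotProduct_smul, Matrix.mulVec_single_one,
    dotProduct_col_eq_mulVec_apply hA, single_one_dotProduct, single_one_dotProduct,
    Matrix.col_apply]
  simp only [smul_eq_mul]
  ring

lemma sum_norm_sub_norm_zeroRowCol_le (hA : A.IsHermitian) :
    ∑ i, (‖A‖ - ‖zeroRowCol A i‖) ≤ 3 * ‖A‖ := by
  cases isEmpty_or_nonempty ι
  · simp
  obtain ⟨u, r, hu, hru, hr⟩ := exists_eigenvector_abs_eigenvalue_eq_norm hA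
  have hterm : ∀ i, ‖A‖ - ‖zeroRowCol A i‖ ≤ 3 * ‖A‖ * (u i * u i) := fun i => by
    calc ‖A‖ - ‖zeroRowCol A i‖
        ≤ |u ⬝ᵥ (A - zeroRowCol A i) *ᵥ u| := norm_sub_norm_le_abs_dotProduct hu hru hr _
      _ = |2 * r - A i i| * (u i * u i) := by
          rw [dotProduct_sub_zeroRowCol_mulVec hA, hru, Pi.smul_apply, smul_eq_mul,
            ← abs_mul_self (u i), ← abs_mul]
          ring_nf
      _ ≤ 3 * ‖A‖ * (u i * u i) := by
          gcongr
          · exact mul_self_nonneg _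
          · have := abs_diag_le_norm A i
            rw [abs_le] at this ⊢
            constructor <;> linarith [abs_le.1 hr.le]
  calc ∑ i, (‖A‖ - ‖zeroRowCol A i‖) ≤ ∑ i, 3 * ‖A‖ * (u i * u i) :=
        Finset.sum_le_sum fun i _ => hterm i
    _ = 3 * ‖A‖ := by rw [← Finset.mul_sum, ← dotProduct, hu, mul_one]

lemma sub_div_le_edgeResolvent_zeroRowCol_diag (hA : A.IsHermitian) (i j : ι) :
    edgeResolvent A j j - edgeResolvent A j i ^ 2 / edgeResolvent A i i
      ≤ edgeResolvent (zeroRowCol A i) j j := by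
  set R := edgeResolvent A
  have hRii : R i i ≠ 0 := (edgeResolvent_diag_pos hA i).ne'
  have hRsymm : R i j = R j i := (isHermitian_edgeResolvent hA).apply j i
  set x : ι → ℝ := Pi.single j 1 - (R j i / R i i) • Pi.single i 1 with hx
  set w := R *ᵥ x
  have hwk : ∀ k, w k = R k j - R j i / R i i * R k i := fun k => by
    simp [w, x, Matrix.mulVec_sub, Matrix.mulVec_smul]
  have hwi : w i = 0 := by
    rw [hwk, hRsymm]
    field_simp
    ring
  have hwj : w j = R j j - R j i ^ 2 / R i i := by
    rw [hwk]
    ring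
  have hwAw : (‖A‖ + 1) * (w ⬝ᵥ w) - w ⬝ᵥ A *ᵥ w = w j := by
    have h := congrArg (w ⬝ᵥ ·) (edge_mulVec_edgeResolvent_mulVec hA x)
    simp only [dotProduct_sub, dotProduct_smul, smul_eq_mul] at h
    rw [h, hx, dotProduct_sub, dotProduct_smul, dotProduct_single_one, dotProduct_single_one, hwi,
      smul_zero, sub_zero]
  have hvar := le_dotProduct_edgeResolvent_mulVec (isHermitian_zeroRowCol hA i) (Pi.single j 1) w
  rw [dotProduct_zeroRowCol_mulVec_of_apply_eq_zero hwi, single_one_dotProduct,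
    single_one_dotProduct, Matrix.mulVec_single_one, Matrix.col_apply] at hvar
  have hnorm := mul_le_mul_of_nonneg_right (norm_zeroRowCol_le hA i) (dotProduct_self_star_nonneg w)
  rw [star_trivial] at hnorm
  rw [← hwj]
  linarith

lemma trace_edgeResolvent_sub_one_le (hA : A.IsHermitian) (i : ι) :
    (edgeResolvent A).trace - 1
      ≤ ∑ j ∈ Finset.univ.erase i, edgeResolvent (zeroRowCol A i) j j := by
  have hpos := edgeResolvent_diag_pos hA i
  have hle : ∑ j, edgeResolvent A j i ^ 2 / edgeResolvent A i i ≤ 1 := by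
    rw [← Finset.sum_div]
    exact (div_le_one hpos).2 (sum_sq_edgeResolvent_le hA i)
  calc (edgeResolvent A).trace - 1
      ≤ ∑ j, (edgeResolvent A j j - edgeResolvent A j i ^ 2 / edgeResolvent A i i) := by
        rw [Finset.sum_sub_distrib]
        exact sub_le_sub_left hle _
    _ = ∑ j ∈ Finset.univ.erase i,
          (edgeResolvent A j j - edgeResolvent A j i ^ 2 / edgeResolvent A i i) := by
        refine (Finset.sum_erase _ ?_).symm
        field_simp
        ring
    _ ≤ ∑ j ∈ Finset.univ.erase i, edgeResolvent (zeroRowCol A i) j j :=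
        Finset.sum_le_sum fun j _ => sub_div_le_edgeResolvent_zeroRowCol_diag hA i j

lemma edgeResolvent_zeroRowCol_mulVec_offDiagRow_apply (hA : A.IsHermitian) (i : ι) :
    (edgeResolvent (zeroRowCol A i) *ᵥ offDiagRow A i) i = 0 := by
  have h := congrFun (edge_mulVec_edgeResolvent_mulVec (isHermitian_zeroRowCol hA i)
    (offDiagRow A i)) i
  have hrow : ∀ y : ι → ℝ, (zeroRowCol A i *ᵥ y) i = 0 := fun y => by
    simp [Matrix.mulVec, dotProduct, zeroRowCol]
  rw [Pi.sub_apply, hrow, sub_zero, offDiagRow, Function.update_self, Pi.smul_apply,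
    smul_eq_mul] at h
  exact (mul_eq_zero.1 h).resolve_left (by positivity)

lemma edge_form_single_add_smul (hA : A.IsHermitian) (i : ι) (t : ℝ) {y w : ι → ℝ}
    (hy : y = edgeResolvent (zeroRowCol A i) *ᵥ offDiagRow A i) (hw : w = Pi.single i 1 + t • y) :
    (‖A‖ + 1) * (w ⬝ᵥ w) - w ⬝ᵥ A *ᵥ w
      = ‖A‖ + 1 - A i i - 2 * t * schurForm A i
        + t ^ 2 * (schurForm A i + (‖A‖ - ‖zeroRowCol A i‖) * (y ⬝ᵥ y)) := by
  have hyi : y i = 0 := hy ▸ edgeResolvent_zeroRowCol_mulVec_offDiagRow_apply hA i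
  have hrow : (A *ᵥ y) i = schurForm A i := by
    rw [schurForm, ← hy]
    refine Finset.sum_congr rfl fun j _ => ?_
    by_cases hj : j = i
    · rw [hj, hyi, mul_zero, mul_zero]
    · rw [offDiagRow, Function.update_of_ne hj]
  have hyy : (‖zeroRowCol A i‖ + 1) * (y ⬝ᵥ y) - y ⬝ᵥ A *ᵥ y = schurForm A i := by
    have h := congrArg (y ⬝ᵥ ·)
      (edge_mulVec_edgeResolvent_mulVec (isHermitian_zeroRowCol hA i) (offDiagRow A i))
    simp only [← hy, dotProduct_sub, dotProduct_smul, smul_eq_mul] at h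
    rw [← dotProduct_zeroRowCol_mulVec_of_apply_eq_zero hyi, h, schurForm, ← hy, dotProduct_comm]
  simp only [hw, Matrix.mulVec_add, Matrix.mulVec_smul, dotProduct_add, add_dotProduct,
    dotProduct_smul, smul_dotProduct, smul_eq_mul, single_one_dotProduct, dotProduct_single_one,
    Pi.add_apply, Pi.smul_apply, Pi.single_eq_same, Matrix.mulVec_single_one, Matrix.col_apply,
    dotProduct_col_eq_mulVec_apply hA, hyi, hrow]
  linear_combination t ^ 2 * hyy

lemma le_edgeResolvent_diag (hA : A.IsHermitian) (i : ι) (c : ℝ) :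
    2 * c - c ^ 2 * (‖A‖ + 1 - A i i - schurForm A i + 2 * ‖A‖ * (‖A‖ - ‖zeroRowCol A i‖))
      ≤ edgeResolvent A i i := by
  set δ := ‖A‖ - ‖zeroRowCol A i‖
  set q := schurForm A i with hq
  set y := edgeResolvent (zeroRowCol A i) *ᵥ offDiagRow A i with hy
  have hδ : 0 ≤ δ := sub_nonneg.2 (norm_zeroRowCol_le hA i)
  -- Minimizing the form below over `s` gives `s = 1 / (1 + δ)`, up to replacing `y ⬝ᵥ y` by `q`.
  set s := 1 / (1 + δ) with hs
  have hs1 : s * (1 + δ) = 1 := by rw [hs]; field_simp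
  obtain ⟨w, hw⟩ : ∃ w, w = Pi.single i 1 + s • y := ⟨_, rfl⟩
  have hwi : w i = 1 := by
    rw [hw, Pi.add_apply, Pi.single_eq_same, Pi.smul_apply, hy,
      edgeResolvent_zeroRowCol_mulVec_offDiagRow_apply hA, smul_zero, add_zero]
  have hyq : y ⬝ᵥ y ≤ q := by
    rw [hq, schurForm, dotProduct_comm (offDiagRow A i)]
    exact dotProduct_self_edgeResolvent_mulVec_le (isHermitian_zeroRowCol hA i) _
  set F := (‖A‖ + 1) * (w ⬝ᵥ w) - w ⬝ᵥ A *ᵥ w with hF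
  have hF_le : F ≤ ‖A‖ + 1 - A i i - s * q := by
    rw [hF, edge_form_single_add_smul hA i s hy hw]
    linear_combination s ^ 2 * δ * hyq + s * q * hs1
  have hF_ge : 1 ≤ F := by
    have hle : w i * w i ≤ w ⬝ᵥ w :=
      Finset.single_le_sum (fun j _ => mul_self_nonneg (w j)) (Finset.mem_univ i)
    rw [hwi, mul_one] at hle
    exact hle.trans (dotProduct_self_le_edge A w)
  have hsq : s * q ≤ 2 * ‖A‖ := by
    linarith [(abs_le.1 (abs_diag_le_norm A i)).1]
  have hvar := le_dotProduct_edgeResolvent_mulVec hA (Pi.single i 1) (c • w)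
  simp only [Matrix.mulVec_smul, dotProduct_smul, smul_dotProduct, smul_eq_mul,
    single_one_dotProduct, Matrix.mulVec_single_one, Matrix.col_apply, hwi, mul_one] at hvar
  have hF_le' : F ≤ ‖A‖ + 1 - A i i - q + 2 * ‖A‖ * δ := by
    linear_combination hF_le + δ * hsq - q * hs1
  linear_combination hvar + c ^ 2 * hF_le'

lemma le_trace_edgeResolvent (hA : A.IsHermitian) (c : ℝ) :
    2 * c * Fintype.card ι - c ^ 2 * (Fintype.card ι * (‖A‖ + 1) - A.trace
      - ∑ i, schurForm A i + 6 * ‖A‖ ^ 2) ≤ (edgeResolvent A).trace := by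
  have h := Finset.sum_le_sum fun i (_ : i ∈ Finset.univ) => le_edgeResolvent_diag hA i c
  simp only [Finset.sum_sub_distrib, Finset.sum_add_distrib, ← Finset.mul_sum, Finset.sum_const,
    Finset.card_univ, nsmul_eq_mul] at h
  have hδ := sum_norm_sub_norm_zeroRowCol_le hA
  simp only [Finset.sum_sub_distrib, Finset.sum_const, Finset.card_univ, nsmul_eq_mul] at hδ
  simp only [Matrix.trace, Matrix.diag_apply]
  linear_combination h + c ^ 2 * 2 * ‖A‖ * hδ

lemma schurForm_eq_sum (A : Matrix ι ι ℝ) (i : ι) :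
    schurForm A i = ∑ j ∈ Finset.univ.erase i, ∑ k ∈ Finset.univ.erase i,
      A i j * A i k * edgeResolvent (zeroRowCol A i) j k := by
  have hsum : ∀ g : ι → ℝ, offDiagRow A i ⬝ᵥ g = ∑ j ∈ Finset.univ.erase i, A i j * g j :=
    fun g => by
      rw [dotProduct, ← Finset.sum_erase (a := i) _ (by simp [offDiagRow])]
      refine Finset.sum_congr rfl fun j hj => ?_
      rw [offDiagRow, Function.update_of_ne (Finset.ne_of_mem_erase hj)]
  rw [schurForm, hsum]
  refine Finset.sum_congr rfl fun j _ => ?_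
  rw [Matrix.mulVec, dotProduct_comm, hsum, Finset.mul_sum]
  exact Finset.sum_congr rfl fun k _ => (mul_assoc _ _ _).symm

end ZeroRowCol

section EfronStein

open scoped symmDiff

variable {ι α : Type*} [DecidableEq ι]

/-- Exchanges the coordinates in `s` between two points of a product space. The Efron–Stein
inequality comes from these maps preserving the law of a pair of independent copies. -/
def swapOn (s : Finset ι) (z : (ι → α) × (ι → α)) : (ι → α) × (ι → α) :=
  (s.piecewise z.2 z.1, s.piecewise z.1 z.2)

lemma swapOn_swapOn (s t : Finset ι) (z : (ι → α) × (ι → α)) :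
    swapOn s (swapOn t z) = swapOn (s ∆ t) z := by
  refine Prod.ext (funext fun j => ?_) (funext fun j => ?_) <;>
    by_cases hs : j ∈ s <;> by_cases ht : j ∈ t <;>
    simp [swapOn, Finset.piecewise, Finset.mem_symmDiff, hs, ht]

lemma swapOn_empty (z : (ι → α) × (ι → α)) : swapOn ∅ z = z := by
  simp [swapOn]

lemma swapOn_singleton_fst (i : ι) (z : (ι → α) × (ι → α)) :
    (swapOn {i} z).1 = Function.update z.1 i (z.2 i) :=
  Finset.piecewise_singleton _ _ _

variable [Fintype ι] [MeasurableSpace α] {ν : ι → Measure α} [∀ i, IsProbabilityMeasure (ν i)]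
  {f : (ι → α) → ℝ}

lemma measurePreserving_swapOn (s : Finset ι) :
    MeasurePreserving (swapOn s) ((Measure.pi ν).prod (Measure.pi ν))
      ((Measure.pi ν).prod (Measure.pi ν)) := by
  have harrow := measurePreserving_arrowProdEquivProdArrow α α ι ν ν
  have hswap : MeasurePreserving
      (fun (w : ι → α × α) i => (if i ∈ s then Prod.swap else id) (w i))
      (Measure.pi fun i => (ν i).prod (ν i)) (Measure.pi fun i => (ν i).prod (ν i)) :=
    measurePreserving_pi _ _ fun i => by
      split_ifs
      · exact Measure.measurePreserving_swap
      · exact .id _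
  have h := harrow.comp (hswap.comp harrow.symm)
  convert h using 1
  funext z
  refine Prod.ext (funext fun i => ?_) (funext fun i => ?_) <;>
  by_cases hi : i ∈ s <;>
  simp [swapOn, hi, MeasurableEquiv.arrowProdEquivProdArrow, Equiv.arrowProdEquivProdArrow]

lemma integral_comp_swapOn (s : Finset ι) {g : (ι → α) × (ι → α) → ℝ}
    (hg : AEStronglyMeasurable g ((Measure.pi ν).prod (Measure.pi ν))) :
    ∫ z, g (swapOn s z) ∂(Measure.pi ν).prod (Measure.pi ν)
      = ∫ z, g z ∂(Measure.pi ν).prod (Measure.pi ν) := by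
  have h := measurePreserving_swapOn (ν := ν) s
  rw [← integral_map h.measurable.aemeasurable (by rwa [h.map_eq]), h.map_eq]

lemma memLp_comp_swapOn_fst (hf : MemLp f 2 (Measure.pi ν)) (s : Finset ι) :
    MemLp (fun z => f (swapOn s z).1) 2 ((Measure.pi ν).prod (Measure.pi ν)) :=
  (hf.comp_measurePreserving measurePreserving_fst).comp_measurePreserving
    (measurePreserving_swapOn s)

lemma two_mul_integral_mul_sub_swapOn_insert (hf : MemLp f 2 (Measure.pi ν)) {s : Finset ι}
    {i : ι} (hi : i ∉ s) :
    2 * ∫ z, f z.1 * (f (swapOn s z).1 - f (swapOn (insert i s) z).1)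
        ∂(Measure.pi ν).prod (Measure.pi ν)
      = ∫ z, (f z.1 - f (swapOn {i} z).1) * (f (swapOn s z).1 - f (swapOn (insert i s) z).1)
          ∂(Measure.pi ν).prod (Measure.pi ν) := by
  set P := (Measure.pi ν).prod (Measure.pi ν)
  have hL : ∀ t : Finset ι, MemLp (fun z => f (swapOn t z).1) 2 P := memLp_comp_swapOn_fst hf
  have hL0 : MemLp (fun z : (ι → α) × (ι → α) => f z.1) 2 P := hf.comp_fst _
  have hDs : MemLp (fun z => f (swapOn s z).1 - f (swapOn (insert i s) z).1) 2 P :=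
    (hL s).sub (hL (insert i s))
  -- Exchanging the coordinate `i` turns the difference on the left into its negative.
  have hanti : ∫ z, f z.1 * (f (swapOn s z).1 - f (swapOn (insert i s) z).1) ∂P
      = -∫ z, f (swapOn {i} z).1 * (f (swapOn s z).1 - f (swapOn (insert i s) z).1) ∂P := by
    have hs : s ∆ {i} = insert i s := by grind [Finset.mem_symmDiff]
    have his : insert i s ∆ {i} = s := by grind [Finset.mem_symmDiff]
    have h := integral_comp_swapOn {i} (hL0.1.mul hDs.1)
    simp only [Pi.mul_apply, swapOn_swapOn, hs, his] at h
    rw [← h, ← integral_neg]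
    exact integral_congr_ae (.of_forall fun z => by ring)
  have h := integral_sub (hL0.integrable_mul hDs) ((hL {i}).integrable_mul hDs)
  simp only [Pi.mul_apply, ← sub_mul] at h
  linarith

lemma integral_mul_sub_swapOn_insert_le (hf : MemLp f 2 (Measure.pi ν)) {s : Finset ι} {i : ι}
    (hi : i ∉ s) :
    ∫ z, f z.1 * (f (swapOn s z).1 - f (swapOn (insert i s) z).1)
        ∂(Measure.pi ν).prod (Measure.pi ν)
      ≤ 1 / 2 * ∫ z, (f z.1 - f (swapOn {i} z).1) ^ 2 ∂(Measure.pi ν).prod (Measure.pi ν) := by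
  set P := (Measure.pi ν).prod (Measure.pi ν)
  have hDs : MemLp (fun z => f (swapOn s z).1 - f (swapOn (insert i s) z).1) 2 P :=
    (memLp_comp_swapOn_fst hf s).sub (memLp_comp_swapOn_fst hf (insert i s))
  have hDi : MemLp (fun z => f z.1 - f (swapOn {i} z).1) 2 P :=
    (hf.comp_fst _).sub (memLp_comp_swapOn_fst hf {i})
  have hshift : ∫ z, (f (swapOn s z).1 - f (swapOn (insert i s) z).1) ^ 2 ∂P
      = ∫ z, (f z.1 - f (swapOn {i} z).1) ^ 2 ∂P := by
    have his : {i} ∆ s = insert i s := by grind [Finset.mem_symmDiff]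
    have h := integral_comp_swapOn s (hDi.1.pow 2)
    simpa only [Pi.pow_apply, swapOn_swapOn, his] using h
  have hyoung : ∫ z, (f z.1 - f (swapOn {i} z).1)
          * (f (swapOn s z).1 - f (swapOn (insert i s) z).1) ∂P
      ≤ ∫ z, 1 / 2 * ((f z.1 - f (swapOn {i} z).1) ^ 2
          + (f (swapOn s z).1 - f (swapOn (insert i s) z).1) ^ 2) ∂P :=
    integral_mono (hDi.integrable_mul hDs)
      ((hDi.integrable_sq.add hDs.integrable_sq).const_mul _) fun z => by
        dsimp only
        linarith [two_mul_le_add_sq (f z.1 - f (swapOn {i} z).1)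
          (f (swapOn s z).1 - f (swapOn (insert i s) z).1)]
  rw [integral_const_mul, integral_add hDi.integrable_sq hDs.integrable_sq, hshift,
    ← two_mul_integral_mul_sub_swapOn_insert hf hi] at hyoung
  linarith

lemma integral_mul_sub_swapOn_le (hf : MemLp f 2 (Measure.pi ν)) (s : Finset ι) :
    ∫ z, f z.1 * (f z.1 - f (swapOn s z).1) ∂(Measure.pi ν).prod (Measure.pi ν)
      ≤ 1 / 2 * ∑ i ∈ s,
          ∫ z, (f z.1 - f (swapOn {i} z).1) ^ 2 ∂(Measure.pi ν).prod (Measure.pi ν) := by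
  have hL := memLp_comp_swapOn_fst hf
  have hL0 := hf.comp_fst (Measure.pi ν)
  induction s using Finset.induction_on with
  | empty => simp [swapOn_empty]
  | insert i s hi ih =>
    have hsplit : ∀ z : (ι → α) × (ι → α), f z.1 * (f z.1 - f (swapOn (insert i s) z).1)
        = f z.1 * (f z.1 - f (swapOn s z).1)
          + f z.1 * (f (swapOn s z).1 - f (swapOn (insert i s) z).1) := fun z => by ring
    have hadd := integral_add (hL0.integrable_mul (hL0.sub (hL s)))
      (hL0.integrable_mul ((hL s).sub (hL (insert i s))))
    simp only [Pi.mul_apply, Pi.sub_apply, ← hsplit] at hadd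
    rw [hadd, Finset.sum_insert hi]
    linarith [integral_mul_sub_swapOn_insert_le hf hi]

lemma variance_pi_le_half_sum (hf : MemLp f 2 (Measure.pi ν)) :
    variance f (Measure.pi ν) ≤ 1 / 2 * ∑ i,
      ∫ z, (f z.1 - f (swapOn {i} z).1) ^ 2 ∂(Measure.pi ν).prod (Measure.pi ν) := by
  refine le_trans (le_of_eq ?_) (integral_mul_sub_swapOn_le hf Finset.univ)
  have hsub := integral_sub ((hf.comp_fst (Measure.pi ν)).integrable_mul (hf.comp_fst _))
    ((hf.comp_fst (Measure.pi ν)).integrable_mul (hf.comp_snd (Measure.pi ν)))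
  simp only [Pi.mul_apply, ← mul_sub, integral_prod_mul f f,
    integral_fun_fst (fun x => f x * f x)] at hsub
  simp only [swapOn, Finset.piecewise_univ, hsub, variance_eq_sub hf, Pi.pow_apply, sq,
    probReal_univ, one_smul]

/-- Exchanging the coordinate `i` interchanges the positive and negative parts of the difference,
so both carry half of the sum of squares. -/
lemma variance_pi_le_sum_sq_posPart (hf : MemLp f 2 (Measure.pi ν)) :
    variance f (Measure.pi ν) ≤ ∑ i,
      ∫ z, (f z.1 - f (Function.update z.1 i (z.2 i)))⁺ ^ 2
        ∂(Measure.pi ν).prod (Measure.pi ν) := by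
  refine (variance_pi_le_half_sum hf).trans_eq ?_
  rw [Finset.mul_sum]
  refine Finset.sum_congr rfl fun i _ => ?_
  simp only [← swapOn_singleton_fst]
  set P := (Measure.pi ν).prod (Measure.pi ν)
  have hD : MemLp (fun z => f z.1 - f (swapOn {i} z).1) 2 P :=
    (hf.comp_fst _).sub (memLp_comp_swapOn_fst hf {i})
  have hpos : MemLp (fun z => (f z.1 - f (swapOn {i} z).1)⁺) 2 P := hD.pos_part
  have hneg : MemLp (fun z => (f z.1 - f (swapOn {i} z).1)⁻) 2 P := hD.neg_part
  have hswap : ∫ z, (f z.1 - f (swapOn {i} z).1)⁻ ^ 2 ∂P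
      = ∫ z, (f z.1 - f (swapOn {i} z).1)⁺ ^ 2 ∂P := by
    have h := integral_comp_swapOn {i} (hpos.1.pow 2)
    simp only [Pi.pow_apply, swapOn_swapOn, symmDiff_self, Finset.bot_eq_empty, swapOn_empty] at h
    rw [← h]
    exact integral_congr_ae (.of_forall fun z => by dsimp only; rw [← posPart_neg, neg_sub])
  have hsq : ∀ d : ℝ, d ^ 2 = d⁺ ^ 2 + d⁻ ^ 2 := fun d => by
    rcases le_total 0 d with hd | hd <;> simp [hd]
  have hadd := integral_add hpos.integrable_sq hneg.integrable_sq
  simp only [← hsq] at hadd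
  linarith

lemma variance_pi_le_of_sum_sq_posPart_le {v : ℝ} (hf : MemLp f 2 (Measure.pi ν))
    (hv : ∀ᵐ z ∂(Measure.pi ν).prod (Measure.pi ν),
      ∑ i, (f z.1 - f (Function.update z.1 i (z.2 i)))⁺ ^ 2 ≤ v) :
    variance f (Measure.pi ν) ≤ v := by
  set P := (Measure.pi ν).prod (Measure.pi ν)
  have hint : ∀ i, Integrable (fun z => (f z.1 - f (Function.update z.1 i (z.2 i)))⁺ ^ 2) P :=
    fun i => by
      simp only [← swapOn_singleton_fst]
      exact ((hf.comp_fst _).sub (memLp_comp_swapOn_fst hf {i})).pos_part.integrable_sq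
  calc variance f (Measure.pi ν)
      ≤ ∑ i, ∫ z, (f z.1 - f (Function.update z.1 i (z.2 i)))⁺ ^ 2 ∂P :=
        variance_pi_le_sum_sq_posPart hf
    _ = ∫ z, ∑ i, (f z.1 - f (Function.update z.1 i (z.2 i)))⁺ ^ 2 ∂P :=
        (integral_finsetSum _ fun i _ => hint i).symm
    _ ≤ ∫ _, v ∂P := integral_mono_ae (integrable_finsetSum _ fun i _ => hint i)
        (integrable_const v) hv
    _ = v := by rw [integral_const, probReal_univ, one_smul]

end EfronStein

section SymmOfUpper

variable {ι : Type*} [LinearOrder ι]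

/-- The unordered pair `{i, j}`, as an index on or above the diagonal. -/
def upperPair (i j : ι) : {p : ι × ι // p.1 ≤ p.2} :=
  ⟨(min i j, max i j), min_le_max⟩

/-- The symmetric matrix with prescribed entries on and above the diagonal. -/
def symmOfUpper (x : {p : ι × ι // p.1 ≤ p.2} → ℝ) : Matrix ι ι ℝ :=
  Matrix.of fun i j => x (upperPair i j)

lemma isHermitian_symmOfUpper (x : {p : ι × ι // p.1 ≤ p.2} → ℝ) :
    (symmOfUpper x).IsHermitian :=
  Matrix.IsHermitian.ext fun i j => by
    simp only [symmOfUpper, Matrix.of_apply, upperPair, min_comm i, max_comm i, star_trivial]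

lemma symmOfUpper_of_isHermitian {A : Matrix ι ι ℝ} (hA : A.IsHermitian) :
    symmOfUpper (fun p => A p.1.1 p.1.2) = A := by
  ext i j
  rcases le_total i j with hij | hij
  · simp [symmOfUpper, upperPair, hij]
  · simpa [symmOfUpper, upperPair, hij] using hA.apply i j

lemma symmOfUpper_sub_symmOfUpper_update (x : {p : ι × ι // p.1 ≤ p.2} → ℝ)
    (p : {p : ι × ι // p.1 ≤ p.2}) (t : ℝ) :
    symmOfUpper x - symmOfUpper (Function.update x p t) = symmOfUpper (Pi.single p (x p - t)) := by
  ext i j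
  by_cases hp : upperPair i j = p <;> simp [symmOfUpper, hp]

variable [Fintype ι]

lemma abs_dotProduct_symmOfUpper_single_mulVec_le (p : {p : ι × ι // p.1 ≤ p.2}) (d : ℝ)
    (u : ι → ℝ) :
    |u ⬝ᵥ symmOfUpper (Pi.single p d) *ᵥ u| ≤ 2 * |d| * |u p.1.1 * u p.1.2| := by
  have hpair : ∀ q : ι × ι, upperPair q.1 q.2 = p → q = p.1 ∨ q = p.1.swap := by
    rintro ⟨i, j⟩ rfl
    rcases le_total i j with hij | hij <;> simp [upperPair, hij]
  have hsum : u ⬝ᵥ symmOfUpper (Pi.single p d) *ᵥ u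
      = ∑ q : ι × ι with upperPair q.1 q.2 = p, d * (u q.1 * u q.2) := by
    simp only [dotProduct, Matrix.mulVec, Finset.mul_sum, ← Fintype.sum_prod_type',
      Finset.sum_filter]
    refine Finset.sum_congr rfl fun q _ => ?_
    by_cases hq : upperPair q.1 q.2 = p <;> simp [symmOfUpper, hq, mul_left_comm]
  have hsub : ({q : ι × ι | upperPair q.1 q.2 = p} : Finset (ι × ι)) ⊆ {p.1, p.1.swap} :=
    fun q hq => by simpa using hpair q (Finset.mem_filter.1 hq).2
  calc |u ⬝ᵥ symmOfUpper (Pi.single p d) *ᵥ u|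
      ≤ ∑ q : ι × ι with upperPair q.1 q.2 = p, |d * (u q.1 * u q.2)| :=
        hsum ▸ Finset.abs_sum_le_sum_abs _ _
    _ ≤ ∑ q ∈ {p.1, p.1.swap}, |d * (u q.1 * u q.2)| :=
        Finset.sum_le_sum_of_subset_of_nonneg hsub fun _ _ _ => abs_nonneg _
    _ ≤ ({p.1, p.1.swap} : Finset (ι × ι)).card • (|d| * |u p.1.1 * u p.1.2|) := by
        refine Finset.sum_le_card_nsmul _ _ _ fun q hq => ?_
        rcases Finset.mem_insert.1 hq with rfl | hq
        · rw [abs_mul]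
        · rw [Finset.mem_singleton.1 hq, abs_mul, Prod.fst_swap, Prod.snd_swap, mul_comm (u _)]
    _ ≤ 2 • (|d| * |u p.1.1 * u p.1.2|) := by gcongr; exact Finset.card_le_two
    _ = 2 * |d| * |u p.1.1 * u p.1.2| := by rw [nsmul_eq_mul, Nat.cast_two, mul_assoc]

lemma sum_sq_mul_le_sq_dotProduct_self (u : ι → ℝ) :
    ∑ p : {p : ι × ι // p.1 ≤ p.2}, (u p.1.1 * u p.1.2) ^ 2 ≤ (u ⬝ᵥ u) ^ 2 := by
  calc ∑ p : {p : ι × ι // p.1 ≤ p.2}, (u p.1.1 * u p.1.2) ^ 2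
      = ∑ q : ι × ι with q.1 ≤ q.2, (u q.1 * u q.2) ^ 2 :=
        (Finset.sum_subtype _ (by simp) fun q : ι × ι => (u q.1 * u q.2) ^ 2).symm
    _ ≤ ∑ q : ι × ι, (u q.1 * u q.2) ^ 2 :=
        Finset.sum_le_sum_of_subset_of_nonneg (Finset.filter_subset _ _) fun _ _ _ => sq_nonneg _
    _ = (u ⬝ᵥ u) ^ 2 := by
        rw [sq, dotProduct, Finset.sum_mul_sum, ← Fintype.sum_prod_type']
        exact Finset.sum_congr rfl fun q _ => by ring

lemma sum_sq_posPart_norm_symmOfUpper_sub_le {x y : {p : ι × ι // p.1 ≤ p.2} → ℝ} {D : ℝ}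
    (hD : ∀ p, |x p - y p| ≤ D) :
    ∑ p, (‖symmOfUpper x‖ - ‖symmOfUpper (Function.update x p (y p))‖)⁺ ^ 2 ≤ 4 * D ^ 2 := by
  cases isEmpty_or_nonempty ι
  · simp only [Finset.univ_eq_empty, Finset.sum_empty]
    positivity
  obtain ⟨u, r, hu, hur, hr⟩ :=
    exists_eigenvector_abs_eigenvalue_eq_norm (isHermitian_symmOfUpper x)
  have hterm : ∀ p, (‖symmOfUpper x‖ - ‖symmOfUpper (Function.update x p (y p))‖)⁺
      ≤ 2 * D * |u p.1.1 * u p.1.2| := fun p => by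
    have h := norm_sub_norm_le_abs_dotProduct hu hur hr (symmOfUpper (Function.update x p (y p)))
    rw [symmOfUpper_sub_symmOfUpper_update] at h
    refine sup_le ?_ ?_
    · calc _ ≤ _ := h
        _ ≤ 2 * |x p - y p| * |u p.1.1 * u p.1.2| :=
          abs_dotProduct_symmOfUpper_single_mulVec_le p _ u
        _ ≤ 2 * D * |u p.1.1 * u p.1.2| := by gcongr; exact hD p
    · have := (abs_nonneg _).trans (hD p)
      positivity
  calc ∑ p, (‖symmOfUpper x‖ - ‖symmOfUpper (Function.update x p (y p))‖)⁺ ^ 2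
      ≤ ∑ p : {p : ι × ι // p.1 ≤ p.2}, (2 * D * |u p.1.1 * u p.1.2|) ^ 2 := by
        gcongr with p
        exact hterm p
    _ = 4 * D ^ 2 * ∑ p : {p : ι × ι // p.1 ≤ p.2}, (u p.1.1 * u p.1.2) ^ 2 := by
        rw [Finset.mul_sum]
        exact Finset.sum_congr rfl fun p _ => by rw [mul_pow, sq_abs]; ring
    _ ≤ 4 * D ^ 2 * 1 := by
        gcongr
        exact (sum_sq_mul_le_sq_dotProduct_self u).trans_eq (by rw [hu, one_pow])
    _ = 4 * D ^ 2 := mul_one _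

end SymmOfUpper

section NormOfRandomMatrix

variable {Ω : Type*} [MeasurableSpace Ω] {μ : Measure Ω} {ι : Type*}

section Measurability

variable [Fintype ι] [DecidableEq ι] {B : Ω → Matrix ι ι ℝ}

lemma memLp_norm_matrix {q : ENNReal} (hB : ∀ i j, MemLp (fun ω => B ω i j) q μ) :
    MemLp (fun ω => ‖B ω‖) q μ := by
  have hsum : B = fun ω => ∑ i, ∑ j, B ω i j • Matrix.single i j (1 : ℝ) := by
    funext ω
    simpa using Matrix.matrix_eq_sum_single (B ω)
  rw [hsum]
  exact (memLp_finsetSum _ fun i _ => memLp_finsetSum _ fun j _ =>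
    (memLp_top_const (Matrix.single i j (1 : ℝ))).smul (hB i j)).norm

lemma measurable_norm_matrix (hB : ∀ i j, Measurable fun ω => B ω i j) :
    Measurable fun ω => ‖B ω‖ := by
  have hid : Continuous fun M : ι → ι → ℝ => Matrix.of M := continuous_id
  exact hid.norm.measurable.comp (measurable_pi_iff.2 fun i => measurable_pi_iff.2 (hB i))

lemma measurable_inv_apply (hB : ∀ i j, Measurable fun ω => B ω i j) (i j : ι) :
    Measurable fun ω => (B ω)⁻¹ i j := by
  have hB' : Measurable fun ω i j => B ω i j :=
    measurable_pi_iff.2 fun i => measurable_pi_iff.2 (hB i)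
  have hid : Continuous fun M : ι → ι → ℝ => Matrix.of M := continuous_id
  simp only [Matrix.inv_def, Ring.inverse_eq_inv', Matrix.smul_apply, smul_eq_mul]
  exact (hid.matrix_det.measurable.comp hB').inv.mul
    ((hid.matrix_adjugate.matrix_elem i j).measurable.comp hB')

lemma measurable_edgeResolvent_apply (hB : ∀ i j, Measurable fun ω => B ω i j) (i j : ι) :
    Measurable fun ω => edgeResolvent (B ω) i j := by
  refine measurable_inv_apply (fun k l => ?_) i j
  simp only [Matrix.sub_apply, Matrix.smul_apply, smul_eq_mul]
  exact (((measurable_norm_matrix hB).add_const 1).mul_const _).sub (hB k l)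

end Measurability

lemma variance_pi_norm_symmOfUpper_le [LinearOrder ι] [Fintype ι]
    {ν : {p : ι × ι // p.1 ≤ p.2} → Measure ℝ} [∀ p, IsProbabilityMeasure (ν p)] {b : ℝ}
    (hν : ∀ p, ∀ᵐ t ∂ν p, |t| ≤ b) :
    variance (fun x => ‖symmOfUpper x‖) (Measure.pi ν) ≤ 16 * b ^ 2 := by
  have hcoord : ∀ᵐ x ∂Measure.pi ν, ∀ p, |x p| ≤ b := ae_all_iff.2 fun p =>
    (measurePreserving_eval ν p).quasiMeasurePreserving.ae (hν p)
  have hmem : MemLp (fun x => ‖symmOfUpper x‖) 2 (Measure.pi ν) :=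
    memLp_norm_matrix fun i j => .of_bound (measurable_pi_apply _).aestronglyMeasurable b (by
      filter_upwards [hcoord] with x hx using hx (upperPair i j))
  refine variance_pi_le_of_sum_sq_posPart_le hmem ?_
  filter_upwards [Measure.quasiMeasurePreserving_fst.ae hcoord,
    Measure.quasiMeasurePreserving_snd.ae hcoord] with z hx hy
  refine (sum_sq_posPart_norm_symmOfUpper_sub_le (D := 2 * b) fun p => ?_).trans_eq (by ring)
  exact (abs_sub _ _).trans (by linarith [hx p, hy p])

end NormOfRandomMatrix

namespace IsRandomSymmetric

variable {Ω : Type*} [MeasurableSpace Ω] {μ : Measure Ω} {n : ℕ}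
  {A : Ω → Matrix (Fin n) (Fin n) ℝ} {σ : ℝ}

lemma apply_upperPair (hA : IsRandomSymmetric μ A) (ω : Ω) (i j : Fin n) :
    A ω (upperPair i j).1.1 (upperPair i j).1.2 = A ω i j :=
  congrFun₂ (symmOfUpper_of_isHermitian (hA.isHermitian ω)) i j

lemma measurable_edgeResolvent_zeroRowCol_apply (hA : IsRandomSymmetric μ A) (i j k : Fin n) :
    Measurable fun ω => edgeResolvent (zeroRowCol (A ω) i) j k := by
  refine measurable_edgeResolvent_apply (fun l m => ?_) j k
  simp only [zeroRowCol, Matrix.of_apply]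
  split_ifs
  · exact measurable_const
  · exact hA.measurable_entry l m

lemma indepFun_entry_mul_entry_edgeResolvent (hA : IsRandomSymmetric μ A) (i j k l m : Fin n) :
    IndepFun (fun ω => A ω i j * A ω i k) (fun ω => edgeResolvent (zeroRowCol (A ω) i) l m) μ := by
  let S : Finset {p : Fin n × Fin n // p.1 ≤ p.2} := {p | p.1.1 = i ∨ p.1.2 = i}
  have hrow : ∀ j, upperPair i j ∈ S := fun j => by
    rcases le_total i j with hij | hij <;> simp [S, upperPair, hij]
  have hminor : ∀ j k, ¬(j = i ∨ k = i) → upperPair j k ∈ Sᶜ := fun j k hjk => by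
    rcases le_total j k with h | h <;> simp [S, upperPair, h] <;> tauto
  let φ : (S → ℝ) → ℝ := fun x => x ⟨upperPair i j, hrow j⟩ * x ⟨upperPair i k, hrow k⟩
  let B : ((Sᶜ : Finset _) → ℝ) → Matrix (Fin n) (Fin n) ℝ := fun x => Matrix.of fun j k =>
    if h : j = i ∨ k = i then 0 else x ⟨upperPair j k, hminor j k h⟩
  have hφ : Measurable φ := by fun_prop
  have hB : ∀ j k, Measurable fun x => B x j k := fun j k => by
    simp only [B, Matrix.of_apply]
    split_ifs <;> fun_prop
  have hφA : ∀ ω, φ (fun p => A ω p.1.1.1 p.1.1.2) = A ω i j * A ω i k := fun ω => by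
    simp only [φ, hA.apply_upperPair]
  have hBA : ∀ ω, B (fun p => A ω p.1.1.1 p.1.1.2) = zeroRowCol (A ω) i := fun ω => by
    ext j k
    by_cases h : j = i ∨ k = i <;> simp [B, zeroRowCol, h, hA.apply_upperPair]
  have hind := (hA.indep.indepFun_finset S Sᶜ disjoint_compl_right fun p =>
    hA.measurable_entry _ _).comp hφ (measurable_edgeResolvent_apply hB l m)
  simpa only [Function.comp_def, hφA, hBA] using hind

lemma integral_entry_mul_entry_of_ne (hA : IsRandomSymmetric μ A) {i j k : Fin n}
    (hjk : j ≠ k) (h0 : ∫ ω, A ω i j ∂μ = 0) : ∫ ω, A ω i j * A ω i k ∂μ = 0 := by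
  have hne : upperPair i j ≠ upperPair i k := by
    intro h
    have hmin : min i j = min i k := congrArg (fun p => p.1.1) h
    have hmax : max i j = max i k := congrArg (fun p => p.1.2) h
    grind
  have hind := hA.indep.indepFun hne
  simp only [hA.apply_upperPair] at hind
  rw [hind.integral_fun_mul_eq_mul_integral (hA.measurable_entry i j).aestronglyMeasurable
    (hA.measurable_entry i k).aestronglyMeasurable, h0, zero_mul]

variable [IsProbabilityMeasure μ]

lemma memLp_entry (hA : IsRandomSymmetric μ A) (q : ENNReal) (i j : Fin n) :
    MemLp (fun ω => A ω i j) q μ :=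
  .of_bound (hA.measurable_entry i j).aestronglyMeasurable 1 (hA.abs_entry_le_one i j)

lemma memLp_norm (hA : IsRandomSymmetric μ A) (q : ENNReal) : MemLp (fun ω => ‖A ω‖) q μ :=
  memLp_norm_matrix (hA.memLp_entry q)

theorem variance_norm_le (hA : IsRandomSymmetric μ A) :
    variance (fun ω => ‖A ω‖) μ ≤ 16 := by
  let X : {p : Fin n × Fin n // p.1 ≤ p.2} → Ω → ℝ := fun p ω => A ω p.1.1 p.1.2
  have hX : ∀ p, Measurable (X p) := fun p => hA.measurable_entry _ _
  have hlaw := (iIndepFun_iff_map_fun_eq_pi_map fun p => (hX p).aemeasurable).1 hA.indep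
  have : ∀ p, IsProbabilityMeasure (μ.map (X p)) := fun p =>
    Measure.isProbabilityMeasure_map (hX p).aemeasurable
  have hbound : ∀ p, ∀ᵐ t ∂μ.map (X p), |t| ≤ 1 := fun p =>
    (ae_map_iff (hX p).aemeasurable (measurableSet_le measurable_abs measurable_const)).2
      (hA.abs_entry_le_one _ _)
  have hnorm : Measurable fun x : {p : Fin n × Fin n // p.1 ≤ p.2} → ℝ => ‖symmOfUpper x‖ :=
    measurable_norm_matrix fun i j => measurable_pi_apply _
  have h := variance_pi_norm_symmOfUpper_le hbound
  rw [← hlaw, variance_map hnorm.aemeasurable (measurable_pi_iff.2 hX).aemeasurable] at h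
  simpa only [Function.comp_def, X, symmOfUpper_of_isHermitian (hA.isHermitian _), one_pow,
    mul_one] using h

lemma integrable_edgeResolvent_apply (hA : IsRandomSymmetric μ A) (i j : Fin n) :
    Integrable (fun ω => edgeResolvent (A ω) i j) μ :=
  .of_bound (measurable_edgeResolvent_apply hA.measurable_entry i j).aestronglyMeasurable 1
    (.of_forall fun ω => abs_edgeResolvent_apply_le_one (hA.isHermitian ω) i j)

lemma integrable_edgeResolvent_zeroRowCol_apply (hA : IsRandomSymmetric μ A) (i j k : Fin n) :
    Integrable (fun ω => edgeResolvent (zeroRowCol (A ω) i) j k) μ :=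
  .of_bound (hA.measurable_edgeResolvent_zeroRowCol_apply i j k).aestronglyMeasurable 1
    (.of_forall fun ω =>
      abs_edgeResolvent_apply_le_one (isHermitian_zeroRowCol (hA.isHermitian ω) i) j k)

lemma integrable_entry_mul_entry (hA : IsRandomSymmetric μ A) (i j k : Fin n) :
    Integrable (fun ω => A ω i j * A ω i k) μ :=
  (hA.memLp_entry 2 i j).integrable_mul (hA.memLp_entry 2 i k)

lemma integrable_entry_mul_entry_mul_edgeResolvent (hA : IsRandomSymmetric μ A) (i j k : Fin n) :
    Integrable (fun ω => A ω i j * A ω i k * edgeResolvent (zeroRowCol (A ω) i) j k) μ :=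
  (hA.indepFun_entry_mul_entry_edgeResolvent i j k j k).integrable_mul
    (hA.integrable_entry_mul_entry i j k) (hA.integrable_edgeResolvent_zeroRowCol_apply i j k)

lemma integrable_schurForm (hA : IsRandomSymmetric μ A) (i : Fin n) :
    Integrable (fun ω => schurForm (A ω) i) μ := by
  simp only [schurForm_eq_sum]
  exact integrable_finsetSum _ fun j _ => integrable_finsetSum _ fun k _ =>
    hA.integrable_entry_mul_entry_mul_edgeResolvent i j k

lemma integral_schurForm (hA : IsRandomSymmetric μ A) (i : Fin n)
    (h0 : ∀ j, i ≠ j → ∫ ω, A ω i j ∂μ = 0) :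
    ∫ ω, schurForm (A ω) i ∂μ = ∑ j ∈ Finset.univ.erase i,
      variance (fun ω => A ω i j) μ * ∫ ω, edgeResolvent (zeroRowCol (A ω) i) j j ∂μ := by
  have hint := hA.integrable_entry_mul_entry_mul_edgeResolvent i
  simp only [schurForm_eq_sum]
  rw [integral_finsetSum _ fun j _ => integrable_finsetSum _ fun k _ => hint j k]
  refine Finset.sum_congr rfl fun j hj => ?_
  have hj0 := h0 j (Finset.ne_of_mem_erase hj).symm
  have hmul : ∀ k, ∫ ω, A ω i j * A ω i k * edgeResolvent (zeroRowCol (A ω) i) j k ∂μ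
      = (∫ ω, A ω i j * A ω i k ∂μ) * ∫ ω, edgeResolvent (zeroRowCol (A ω) i) j k ∂μ := fun k =>
    (hA.indepFun_entry_mul_entry_edgeResolvent i j k j k).integral_fun_mul_eq_mul_integral
      (hA.integrable_entry_mul_entry i j k).aestronglyMeasurable
      (hA.measurable_edgeResolvent_zeroRowCol_apply i j k).aestronglyMeasurable
  rw [integral_finsetSum _ fun k _ => hint j k, Finset.sum_eq_single_of_mem j hj fun k _ hkj => by
    rw [hmul, hA.integral_entry_mul_entry_of_ne hkj.symm hj0, zero_mul]]
  rw [hmul, variance_of_integral_eq_zero (hA.measurable_entry i j).aemeasurable hj0]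
  simp only [sq]

lemma mul_integral_trace_sub_one_le_integral_schurForm (hA : IsRandomSymmetric μ A) (i : Fin n)
    (h0 : ∀ j, i ≠ j → ∫ ω, A ω i j ∂μ = 0)
    (hvar : ∀ j, i ≠ j → σ ^ 2 ≤ variance (fun ω => A ω i j) μ) :
    σ ^ 2 * (∫ ω, (edgeResolvent (A ω)).trace ∂μ - 1) ≤ ∫ ω, schurForm (A ω) i ∂μ := by
  have htrace : Integrable (fun ω => (edgeResolvent (A ω)).trace) μ :=
    integrable_finsetSum _ fun j _ => hA.integrable_edgeResolvent_apply j j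
  have hminor := hA.integrable_edgeResolvent_zeroRowCol_apply i
  calc σ ^ 2 * (∫ ω, (edgeResolvent (A ω)).trace ∂μ - 1)
      = σ ^ 2 * ∫ ω, ((edgeResolvent (A ω)).trace - 1) ∂μ := by
        rw [integral_sub htrace (integrable_const _), integral_const, probReal_univ, one_smul]
    _ ≤ σ ^ 2 * ∫ ω, ∑ j ∈ Finset.univ.erase i, edgeResolvent (zeroRowCol (A ω) i) j j ∂μ := by
        refine mul_le_mul_of_nonneg_left (integral_mono (htrace.sub (integrable_const _))
          (integrable_finsetSum _ fun j _ => hminor j j) fun ω => ?_) (sq_nonneg σ)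
        exact trace_edgeResolvent_sub_one_le (hA.isHermitian ω) i
    _ = ∑ j ∈ Finset.univ.erase i, σ ^ 2 * ∫ ω, edgeResolvent (zeroRowCol (A ω) i) j j ∂μ := by
        rw [integral_finsetSum _ fun j _ => hminor j j, Finset.mul_sum]
    _ ≤ ∑ j ∈ Finset.univ.erase i,
          variance (fun ω => A ω i j) μ * ∫ ω, edgeResolvent (zeroRowCol (A ω) i) j j ∂μ := by
        refine Finset.sum_le_sum fun j hj => ?_
        refine mul_le_mul_of_nonneg_right (hvar j (Finset.ne_of_mem_erase hj).symm)
          (integral_nonneg fun ω => ?_)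
        exact (edgeResolvent_diag_pos (isHermitian_zeroRowCol (hA.isHermitian ω) i) j).le
    _ = ∫ ω, schurForm (A ω) i ∂μ := (hA.integral_schurForm i h0).symm

lemma sq_le_one_of_le_variance (hA : IsRandomSymmetric μ A) {i j : Fin n}
    (hvar : σ ^ 2 ≤ variance (fun ω => A ω i j) μ) : σ ^ 2 ≤ 1 := by
  refine hvar.trans ((variance_le_expectation_sq
    (hA.measurable_entry i j).aestronglyMeasurable).trans ?_)
  calc ∫ ω, A ω i j ^ 2 ∂μ ≤ ∫ _, (1 : ℝ) ∂μ :=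
        integral_mono_ae (hA.memLp_entry 2 i j).integrable_sq (integrable_const 1) (by
          filter_upwards [hA.abs_entry_le_one i j] with ω h using (sq_le_one_iff_abs_le_one _).2 h)
    _ = 1 := by rw [integral_const, probReal_univ, one_smul]

lemma neg_card_le_integral_trace (hA : IsRandomSymmetric μ A) :
    -(n : ℝ) ≤ ∫ ω, (A ω).trace ∂μ := by
  have hentry : ∀ i, -1 ≤ ∫ ω, A ω i i ∂μ := fun i => by
    have h := integral_mono_ae (integrable_const (-1)) ((hA.memLp_entry 1 i i).integrable le_rfl)
      (by filter_upwards [hA.abs_entry_le_one i i] with ω h using (abs_le.1 h).1)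
    rwa [integral_const, probReal_univ, one_smul] at h
  simp only [Matrix.trace, Matrix.diag_apply]
  rw [integral_finsetSum _ fun i _ => (hA.memLp_entry 1 i i).integrable le_rfl]
  simpa using Finset.sum_le_sum fun i (_ : i ∈ Finset.univ) => hentry i

lemma le_integral_trace_edgeResolvent (hA : IsRandomSymmetric μ A) (c : ℝ) :
    2 * c * n - c ^ 2 * (n * (∫ ω, ‖A ω‖ ∂μ + 1) - ∫ ω, (A ω).trace ∂μ
      - ∑ i, ∫ ω, schurForm (A ω) i ∂μ + 6 * ∫ ω, ‖A ω‖ ^ 2 ∂μ)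
      ≤ ∫ ω, (edgeResolvent (A ω)).trace ∂μ := by
  have hnorm : Integrable (fun ω => ‖A ω‖) μ := (hA.memLp_norm 1).integrable le_rfl
  have hsq : Integrable (fun ω => ‖A ω‖ ^ 2) μ := (hA.memLp_norm 2).integrable_sq
  have htrace : Integrable (fun ω => (A ω).trace) μ :=
    integrable_finsetSum _ fun i _ => (hA.memLp_entry 1 i i).integrable le_rfl
  have hschur : Integrable (fun ω => ∑ i, schurForm (A ω) i) μ :=
    integrable_finsetSum _ fun i _ => hA.integrable_schurForm i
  have hres : Integrable (fun ω => (edgeResolvent (A ω)).trace) μ :=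
    integrable_finsetSum _ fun i _ => hA.integrable_edgeResolvent_apply i i
  have hz : Integrable (fun ω => (n : ℝ) * (‖A ω‖ + 1)) μ :=
    (hnorm.add (integrable_const 1)).const_mul _
  have hzt : Integrable (fun ω => n * (‖A ω‖ + 1) - (A ω).trace) μ := hz.sub htrace
  have hzts : Integrable (fun ω => n * (‖A ω‖ + 1) - (A ω).trace - ∑ i, schurForm (A ω) i) μ :=
    hzt.sub hschur
  have hbracket : Integrable (fun ω => n * (‖A ω‖ + 1) - (A ω).trace
      - ∑ i, schurForm (A ω) i + 6 * ‖A ω‖ ^ 2) μ := hzts.add (hsq.const_mul 6)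
  have h := integral_mono ((integrable_const (2 * c * n)).sub (hbracket.const_mul (c ^ 2))) hres
    fun ω => by simpa using le_trace_edgeResolvent (hA.isHermitian ω) c
  simp only [Pi.sub_apply] at h
  rwa [integral_sub (integrable_const _) (hbracket.const_mul _), integral_const_mul (c ^ 2),
    integral_add hzts (hsq.const_mul 6), integral_const_mul 6, integral_sub hzt hschur,
    integral_sub hz htrace, integral_const_mul (n : ℝ), integral_add hnorm (integrable_const 1),
    integral_finsetSum _ fun i _ => hA.integrable_schurForm i, integral_const, integral_const,
    probReal_univ, one_smul, one_smul] at h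

lemma two_mul_mul_sqrt_le_integral_norm_add (hA : IsRandomSymmetric μ A) (hσ : 0 < σ) (hn : 0 < n)
    (h0 : ∀ i j, i ≠ j → ∫ ω, A ω i j ∂μ = 0)
    (hvar : ∀ i j, i ≠ j → σ ^ 2 ≤ variance (fun ω => A ω i j) μ) :
    2 * σ * √n ≤ ∫ ω, ‖A ω‖ ∂μ + 2 + σ ^ 2 + 6 * (∫ ω, ‖A ω‖ ^ 2 ∂μ) / n := by
  have hn' : (0 : ℝ) < n := Nat.cast_pos.2 hn
  have hsqrt : √(n : ℝ) ^ 2 = n := Real.sq_sqrt hn'.le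
  set T := ∫ ω, (edgeResolvent (A ω)).trace ∂μ
  set L := ∫ ω, ‖A ω‖ ∂μ
  set M := ∫ ω, ‖A ω‖ ^ 2 ∂μ
  have hschur : n * (σ ^ 2 * (T - 1)) ≤ ∑ i, ∫ ω, schurForm (A ω) i ∂μ := by
    simpa using Finset.sum_le_sum fun i (_ : i ∈ Finset.univ) =>
      hA.mul_integral_trace_sub_one_le_integral_schurForm i (h0 i) (hvar i)
  -- With this choice the coefficient of `T` is the same on both sides.
  set c := 1 / (σ * √n) with hc
  have hcn : c ^ 2 * n = 1 / σ ^ 2 := by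
    rw [hc, div_pow, mul_pow, hsqrt]
    field_simp
  have hbracket : n * (L + 1) - ∫ ω, (A ω).trace ∂μ - ∑ i, ∫ ω, schurForm (A ω) i ∂μ + 6 * M
      ≤ n * (L + 2 - σ ^ 2 * (T - 1) + 6 * M / n) := by
    have hM : n * (6 * M / n) = 6 * M := by field_simp
    linarith [hA.neg_card_le_integral_trace]
  have hself : 2 * c * n - 1 / σ ^ 2 * (L + 2 - σ ^ 2 * (T - 1) + 6 * M / n) ≤ T := by
    have h := mul_le_mul_of_nonneg_left hbracket (sq_nonneg c)
    rw [← mul_assoc, hcn] at h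
    linarith [hA.le_integral_trace_edgeResolvent c]
  have hcσ : σ ^ 2 * (2 * c * n) = 2 * σ * √n := by
    rw [hc]
    field_simp
    rw [hsqrt]
  have h := mul_le_mul_of_nonneg_left hself (sq_nonneg σ)
  rw [mul_sub, hcσ, ← mul_assoc, mul_one_div_cancel (by positivity), one_mul] at h
  linarith

/-- The second moment of the norm is `(∫ ω, ‖A ω‖ ∂μ) ^ 2 + 16` at most, that is `4 * n + 16` in
the nontrivial case, so that the constant is `2 + 1 + 6 * (4 + 16 / 2)`. -/
theorem two_mul_mul_sqrt_sub_le_integral_norm (hA : IsRandomSymmetric μ A) (hn : 2 ≤ n)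
    (h0 : ∀ i j, i ≠ j → ∫ ω, A ω i j ∂μ = 0)
    (hvar : ∀ i j, i ≠ j → σ ^ 2 ≤ variance (fun ω => A ω i j) μ) :
    2 * σ * √n - 75 ≤ ∫ ω, ‖A ω‖ ∂μ := by
  have hn' : (2 : ℝ) ≤ n := Nat.ofNat_le_cast.2 hn
  have hL : 0 ≤ ∫ ω, ‖A ω‖ ∂μ := integral_nonneg fun ω => norm_nonneg _
  have hσ1 : σ ≤ 1 := by
    have hne : (⟨0, by lia⟩ : Fin n) ≠ ⟨1, by lia⟩ := by simp
    exact (sq_le_one_iff_abs_le_one _).1 (hA.sq_le_one_of_le_variance (hvar _ _ hne))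
      |>.trans' (le_abs_self σ)
  rcases le_or_gt σ 0 with hσ | hσ
  · have := mul_nonpos_of_nonpos_of_nonneg hσ (Real.sqrt_nonneg n)
    linarith
  rcases le_or_gt (2 * √n) (∫ ω, ‖A ω‖ ∂μ) with hbig | hsmall
  · have := mul_le_of_le_one_left (Real.sqrt_nonneg n) hσ1
    linarith
  have hsecond : ∫ ω, ‖A ω‖ ^ 2 ∂μ ≤ 4 * n + 16 := by
    have h := hA.variance_norm_le
    rw [variance_eq_sub (hA.memLp_norm 2)] at h
    have hsq := pow_le_pow_left₀ hL hsmall.le 2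
    rw [mul_pow, Real.sq_sqrt (by positivity)] at hsq
    simp only [Pi.pow_apply] at h
    linarith
  have hdiv : 6 * (∫ ω, ‖A ω‖ ^ 2 ∂μ) / n ≤ 72 := by
    rw [div_le_iff₀ (by positivity)]
    linarith
  have hσsq : σ ^ 2 ≤ 1 := pow_le_one₀ hσ.le hσ1
  linarith [hA.two_mul_mul_sqrt_le_integral_norm_add hσ (by lia) h0 hvar]

theorem one_sub_le_measureReal_integral_norm_sub_le (hA : IsRandomSymmetric μ A) {t : ℝ}
    (ht : 0 < t) : 1 - 16 / t ^ 2 ≤ μ.real {ω | ∫ ω', ‖A ω'‖ ∂μ - t ≤ ‖A ω‖} := by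
  set L := ∫ ω', ‖A ω'‖ ∂μ
  have hcover : (Set.univ : Set Ω) ⊆ {ω | L - t ≤ ‖A ω‖} ∪ {ω | t ≤ |‖A ω‖ - L|} := fun ω _ => by
    refine (le_or_gt (L - t) ‖A ω‖).imp id fun h => ?_
    exact (by linarith : t ≤ -(‖A ω‖ - L)).trans (neg_le_abs _)
  have hunion : 1 ≤ μ.real {ω | L - t ≤ ‖A ω‖} + μ.real {ω | t ≤ |‖A ω‖ - L|} := by
    rw [← probReal_univ (μ := μ)]
    exact (measureReal_mono hcover).trans (measureReal_union_le _ _)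
  have hchebyshev : μ.real {ω | t ≤ |‖A ω‖ - L|} ≤ variance (fun ω => ‖A ω‖) μ / t ^ 2 :=
    ENNReal.toReal_le_of_le_ofReal (by have := variance_nonneg (fun ω => ‖A ω‖) μ; positivity)
      (meas_ge_le_variance_div_sq (hA.memLp_norm 2) ht)
  have hvar := div_le_div_of_nonneg_right hA.variance_norm_le (sq_nonneg t)
  linarith

end IsRandomSymmetric

theorem corollary2_general {Ω : Type*} [MeasurableSpace Ω] {μ : Measure Ω}
    [IsProbabilityMeasure μ] {n : ℕ} {A : Ω → Matrix (Fin n) (Fin n) ℝ} {σ : ℝ}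
    (hA : IsRandomSymmetric μ A) (hn : 2 ≤ n)
    (h0 : ∀ i j, i ≠ j → ∫ ω, A ω i j ∂μ = 0)
    (hvar : ∀ i j, i ≠ j → σ ^ 2 ≤ variance (fun ω => A ω i j) μ) :
    Integrable (fun ω => lambda1 (hA.isHermitian ω)) μ ∧
    2 * σ * √n - 75 ≤ ∫ ω, lambda1 (hA.isHermitian ω) ∂μ ∧
    ∀ t : ℝ, 0 < t →
      1 - 16 / t ^ 2 ≤ μ.real {ω | 2 * σ * √n - 75 - t ≤ lambda1 (hA.isHermitian ω)} := by
  have hmean := hA.two_mul_mul_sqrt_sub_le_integral_norm hn h0 hvar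
  simp only [lambda1_eq_norm]
  refine ⟨(hA.memLp_norm 1).integrable le_rfl, hmean, fun t ht => ?_⟩
  refine (hA.one_sub_le_measureReal_integral_norm_sub_le ht).trans (measureReal_mono fun ω hω => ?_)
  exact (sub_le_sub_right hmean t).trans hω

lemma half_le_sqrt_log {n : ℕ} (hn : 2 ≤ n) : 1 / 2 ≤ √(Real.log n) := by
  have hlog : Real.log 2 ≤ Real.log n := Real.log_le_log two_pos (Nat.ofNat_le_cast.2 hn)
  exact Real.le_sqrt_of_sq_le (by linarith [Real.log_two_gt_d9])

lemma tendsto_mul_sqrt_log_sub_atTop {C : ℝ} (hC : 0 < C) (c : ℝ) :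
    Filter.Tendsto (fun n : ℕ => C * √(Real.log n) - c) Filter.atTop Filter.atTop :=
  Filter.tendsto_atTop_add_const_right _ _ <| Filter.Tendsto.const_mul_atTop hC <|
    Real.tendsto_sqrt_atTop.comp <| Real.tendsto_log_atTop.comp tendsto_natCast_atTop_atTop

lemma eventually_div_sq_le {f : ℕ → ℝ} (hf : Filter.Tendsto f Filter.atTop Filter.atTop) (b : ℝ)
    {ε : ℝ} (hε : 0 < ε) : ∀ᶠ n in Filter.atTop, b / f n ^ 2 ≤ ε :=
  (((Filter.tendsto_pow_atTop two_ne_zero).comp hf).const_div_atTop b).eventually_le_const hε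

theorem corollary2 :
    ∃ C : ℝ,
      (∀ n : ℕ, 2 ≤ n →
        ∀ (Ω : Type*) [MeasurableSpace Ω] (μ : Measure Ω) [IsProbabilityMeasure μ]
          (A : Ω → Matrix (Fin n) (Fin n) ℝ) (hA : IsRandomSymmetric μ A)
          (σ : ℝ), 0 ≤ σ →
          (∀ i j, ∫ ω, A ω i j ∂μ = 0) →
          (∀ i j, variance (fun ω => A ω i j) μ = σ ^ 2) →
          Integrable (fun ω => lambda1 (hA.isHermitian ω)) μ ∧
          2 * σ * Real.sqrt n - C * Real.sqrt (Real.log n)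
            ≤ ∫ ω, lambda1 (hA.isHermitian ω) ∂μ) ∧
      (∀ ε : ℝ, 0 < ε → ∃ N : ℕ, ∀ n : ℕ, N ≤ n →
        ∀ (Ω : Type*) [MeasurableSpace Ω] (μ : Measure Ω) [IsProbabilityMeasure μ]
          (A : Ω → Matrix (Fin n) (Fin n) ℝ) (hA : IsRandomSymmetric μ A)
          (σ : ℝ), 0 ≤ σ →
          (∀ i j, ∫ ω, A ω i j ∂μ = 0) →
          (∀ i j, variance (fun ω => A ω i j) μ = σ ^ 2) →
          1 - ε ≤ μ.real {ω | 2 * σ * Real.sqrt n - C * Real.sqrt (Real.log n)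
            ≤ lambda1 (hA.isHermitian ω)}) := by
  refine ⟨150, fun n hn Ω _ μ _ A hA σ _ h0 hvar => ?_, fun ε hε => ?_⟩
  · obtain ⟨hint, hmean, -⟩ :=
      corollary2_general hA hn (fun i j _ => h0 i j) fun i j _ => (hvar i j).ge
    exact ⟨hint, by linarith [half_le_sqrt_log hn]⟩
  · have hmargin := tendsto_mul_sqrt_log_sub_atTop (C := 150) (by norm_num) 75
    obtain ⟨N, hN⟩ := Filter.eventually_atTop.1 <| (Filter.eventually_ge_atTop 2).and <|
      (hmargin.eventually_gt_atTop 0).and (eventually_div_sq_le hmargin 16 hε)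
    refine ⟨N, fun n hn Ω _ μ _ A hA σ _ h0 hvar => ?_⟩
    obtain ⟨hn2, hpos, hle⟩ := hN n hn
    obtain ⟨-, -, hprob⟩ :=
      corollary2_general hA hn2 (fun i j _ => h0 i j) fun i j _ => (hvar i j).ge
    have h := hprob _ hpos
    rw [sub_sub, add_sub_cancel] at h
    exact (sub_le_sub_left hle 1).trans h
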